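/- Let $\sigma$ be a first-order vocabulary (relation symbols, function symbols, constants). Formulas over $\sigma$ may use equality and are built from atoms and $\bot$ by Boolean connectives and quantifiers; a formula is equality-free if it contains no atom $t_1=t_2$. Structures have non-empty universes. For formulas $\varphi,\chi$ and a set $\Gamma$ of formulas over a vocabulary, write $\varphi\equiv_{\mathrm{Th}(\Gamma)}\chi$ if $\varphi$ and $\chi$ have the same truth value in every structure with an assignment of the free variables that satisfies all formulas of $\Gamma$. Let $E$ be a binary relation symbol not in $\sigma$. For a formula $\varphi$ over $\sigma$ let $\varphi^*$ be the formula over $\sigma\cup\{E\}$ obtained by replacing every atom $t_1=t_2$ by $E(t_1,t_2)$, and let $\Gamma^*=\{\varphi^*\mid\varphi\in\Gamma\}$. Let $\Delta_E$ be the set of sentences saying that $E$ is a congruence for $\sigma$: $E$ is reflexive, symmetric and transitive, and for each function symbol $f$ (constants included) and each relation symbol $R$ of $\sigma$, $$\forall\bar x\,\forall\bar y\Big(\bigwedge_i E(x_i,y_i)\to E(f(\bar x),f(\bar y))\Big),\qquad \forall\bar x\,\forall\bar y\Big(\bigwedge_i E(x_i,y_i)\to (R(\bar x)\leftrightarrow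 R(\bar y))\Big).$$ If $\sigma$ is finite, let $\delta_E$ be the conjunction of these sentences. Lemma. Let $\psi$ be a formula and $\Gamma$ a finite set of formulas over $\sigma$. Then the following are equivalent: (i) there is an equality-free formula $\varphi$ over $\sigma$ with $\psi\equiv_{\mathrm{Th}(\Gamma)}\varphi$; (ii) there is a formula $\mu$ over $\sigma$ (not using $E$, but possibly using equality) with $\psi^*\equiv_{\mathrm{Th}(\Gamma^*\cup\Delta_E)}\mu$. If $\sigma$ is finite, the same equivalence holds with $\{\delta_E\}$ in place of $\Delta_E$. That is, equality is necessary to express $\psi$ modulo $\mathrm{Th}(\Gamma)$ if and only if the symbol $E$ is necessary to express $\psi^*$ modulo $\mathrm{Th}(\Gamma^*\cup\{\delta_E\})$. -/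

import Mathlib

universe u v w

namespace EqElim

open FirstOrder FirstOrder.Language

/-- The relation symbols of the vocabulary `{E}`: a single symbol, of arity two. -/
inductive ESymb : ℕ → Type
  | E : ESymb 2

/-- The vocabulary `{E}`, with one binary relation symbol and no function symbols. -/
def LE : FirstOrder.Language.{0, 0} := ⟨fun _ => Empty, ESymb⟩

/-- The vocabulary `σ ∪ {E}`; the disjoint sum makes `E` fresh for `σ`. -/
abbrev WithE (L : FirstOrder.Language.{u, v}) : FirstOrder.Language.{u, v} := L.sum LE

variable {L : FirstOrder.Language.{u, v}} {α : Type w}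

/-- The inclusion of `σ` into `σ ∪ {E}`. -/
abbrev incl (L : FirstOrder.Language.{u, v}) : L →ᴸ WithE L := LHom.sumInl

/-- The symbol `E` in `σ ∪ {E}`. -/
def symE (L : FirstOrder.Language.{u, v}) : (WithE L).Relations 2 := Sum.inr ESymb.E

/-- The formula has no equality atom. -/
def EqualityFree : ∀ {n : ℕ}, L.BoundedFormula α n → Prop
  | _, .falsum => True
  | _, .equal _ _ => False
  | _, .rel _ _ => True
  | _, .imp φ χ => EqualityFree φ ∧ EqualityFree χ
  | _, .all φ => EqualityFree φ

/-- `φ*`: every equality atom `t₁ = t₂` of `φ` is replaced by `E(t₁, t₂)`. -/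
def star : ∀ {n : ℕ}, L.BoundedFormula α n → (WithE L).BoundedFormula α n
  | _, .falsum => .falsum
  | _, .equal t₁ t₂ => (symE L).boundedFormula₂ ((incl L).onTerm t₁) ((incl L).onTerm t₂)
  | _, .rel R ts => ((incl L).onRelation R).boundedFormula fun i => (incl L).onTerm (ts i)
  | _, .imp φ χ => (star φ).imp (star χ)
  | _, .all φ => (star φ).all

/-- The atom `E(xᵢ, xⱼ)` in bound variables. -/
def atomE {n : ℕ} (i j : Fin n) : (WithE L).BoundedFormula α n :=
  (symE L).boundedFormula₂ (Term.var (Sum.inr i)) (Term.var (Sum.inr j))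

/-- `∀ x, E(x, x)`. -/
def reflAxiom (L : FirstOrder.Language.{u, v}) (α : Type w) : (WithE L).Formula α :=
  BoundedFormula.alls (n := 1) (atomE 0 0)

/-- `∀ x y, E(x, y) → E(y, x)`. -/
def symmAxiom (L : FirstOrder.Language.{u, v}) (α : Type w) : (WithE L).Formula α :=
  BoundedFormula.alls (n := 2) ((atomE 0 1).imp (atomE 1 0))

/-- `∀ x y z, E(x, y) → E(y, z) → E(x, z)`. -/
def transAxiom (L : FirstOrder.Language.{u, v}) (α : Type w) : (WithE L).Formula α :=
  BoundedFormula.alls (n := 3) ((atomE 0 1).imp ((atomE 1 2).imp (atomE 0 2)))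

/-- The conjunction `E(x₁, y₁) ∧ … ∧ E(xₙ, yₙ)`. -/
noncomputable def pairwiseE (n : ℕ) : (WithE L).BoundedFormula α (n + n) :=
  BoundedFormula.iInf fun i : Fin n => atomE (Fin.castAdd n i) (Fin.natAdd n i)

/-- The term `f(x₁, …, xₙ)`. -/
def leftTerm {n : ℕ} (f : L.Functions n) : (WithE L).Term (α ⊕ Fin (n + n)) :=
  Term.func ((incl L).onFunction f) fun i => Term.var (Sum.inr (Fin.castAdd n i))

/-- The term `f(y₁, …, yₙ)`. -/
def rightTerm {n : ℕ} (f : L.Functions n) : (WithE L).Term (α ⊕ Fin (n + n)) :=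
  Term.func ((incl L).onFunction f) fun i => Term.var (Sum.inr (Fin.natAdd n i))

/-- The atom `R(x₁, …, xₙ)`. -/
def leftAtom {n : ℕ} (R : L.Relations n) : (WithE L).BoundedFormula α (n + n) :=
  ((incl L).onRelation R).boundedFormula fun i => Term.var (Sum.inr (Fin.castAdd n i))

/-- The atom `R(y₁, …, yₙ)`. -/
def rightAtom {n : ℕ} (R : L.Relations n) : (WithE L).BoundedFormula α (n + n) :=
  ((incl L).onRelation R).boundedFormula fun i => Term.var (Sum.inr (Fin.natAdd n i))

/-- `E` is compatible with a symbol of `σ`: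
`∀ x̄ ȳ, ⋀ᵢ E(xᵢ, yᵢ) → E(f(x̄), f(ȳ))` for a function symbol `f` (constants have arity zero),
`∀ x̄ ȳ, ⋀ᵢ E(xᵢ, yᵢ) → (R(x̄) ↔ R(ȳ))` for a relation symbol `R`. -/
noncomputable def compatAxiom (α : Type w) : L.Symbols → (WithE L).Formula α
  | Sum.inl ⟨n, f⟩ =>
      ((pairwiseE n).imp ((symE L).boundedFormula₂ (leftTerm f) (rightTerm f))).alls
  | Sum.inr ⟨n, R⟩ =>
      ((pairwiseE n).imp ((leftAtom R).iff (rightAtom R))).alls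

/-- The sentences saying that `E` is a congruence for all symbols of `σ`. -/
def congruenceAxioms (L : FirstOrder.Language.{u, v}) (α : Type w) : Set ((WithE L).Formula α) :=
  {reflAxiom L α, symmAxiom L α, transAxiom L α} ∪ Set.range (compatAxiom (L := L) α)

/-- `δ_E`: for a finite vocabulary, the single sentence saying that `E` is a congruence for all
symbols of `σ`. -/
noncomputable def deltaE (L : FirstOrder.Language.{u, v}) [Finite L.Symbols] (α : Type w) :
    (WithE L).Formula α :=
  reflAxiom L α ⊓ symmAxiom L α ⊓ transAxiom L α ⊓ BoundedFormula.iInf (compatAxiom (L := L) α)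

/-- `φ ≡_{Th(Γ)} χ`: the formulas `φ` and `χ` agree in every (non-empty) structure with an
assignment `s` of the free variables that satisfies all members of `Γ`. If `Γ` consists of
sentences, these are all the assignments in the models of `Γ`. -/
def EquivModulo (Γ : Set (L.Formula α)) (φ χ : L.Formula α) : Prop :=
  ∀ (M : Type max u v w) [Nonempty M] [L.Structure M] (s : α → M),
    (∀ γ ∈ Γ, γ.Realize s) → (φ.Realize s ↔ χ.Realize s)

end EqElim

/-! If `φ` is equality-free, then `φ*` is `φ` itself. A structure whose `E` is a congruence
satisfies `θ*` exactly when its quotient by `E` satisfies `θ`. Hence an equality-free equivalent of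
`ψ` serves as `μ`.

Conversely, by compactness (`exists_equalityFree_of_eqFreeEquiv`) it suffices that any `(A, s)` and
`(B, t)` satisfying `Γ` and agreeing on equality-free formulas also agree on `ψ`. A back-and-forth
chain (`Correspondence.exists_common_cover`) yields elementary extensions `X` of `A` and `Y` of `B`,
and one structure `N` mapped onto both. The maps preserve functions, preserve and reflect relations,
and send a common assignment to `s` and to `t`. With `E` read on `N` as the kernel of either map,
`Γ*` and the congruence axioms hold, and `ψ*` says what `ψ` says in the image
(`IsEQuotient.realize_star`). Since `μ` does not contain `E`, its truth value in `N` is the same for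
both kernels, so `ψ` holds at `s` iff it holds at `t`. -/

namespace EqElim

open FirstOrder FirstOrder.Language

variable {L : FirstOrder.Language.{u, v}}

/-! ### Closure properties of equality-free formulas -/

section EqualityFree

variable {α β : Type*} {n : ℕ}

theorem EqualityFree.not {φ : L.BoundedFormula α n} (h : EqualityFree φ) : EqualityFree φ.not :=
  ⟨h, trivial⟩

theorem EqualityFree.inf {φ χ : L.BoundedFormula α n} (hφ : EqualityFree φ)
    (hχ : EqualityFree χ) : EqualityFree (φ ⊓ χ) :=
  ⟨⟨hφ, hχ, trivial⟩, trivial⟩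

theorem equalityFree_top : EqualityFree (⊤ : L.BoundedFormula α n) :=
  ⟨trivial, trivial⟩

theorem EqualityFree.exs : ∀ {n : ℕ} {φ : L.BoundedFormula α n}, EqualityFree φ →
    EqualityFree φ.exs
  | 0, _, h => h
  | _ + 1, φ, h => EqualityFree.exs (φ := φ.ex) ⟨⟨h, trivial⟩, trivial⟩

theorem EqualityFree.castLE {φ : L.BoundedFormula α n} (h : EqualityFree φ) :
    ∀ {m : ℕ} (hm : n ≤ m), EqualityFree (φ.castLE hm) := by
  induction φ with
  | falsum => exact fun _ => trivial
  | equal => exact h.elim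
  | rel => exact fun _ => trivial
  | imp _ _ ih₁ ih₂ => exact fun _ => ⟨ih₁ h.1 _, ih₂ h.2 _⟩
  | all _ ih => exact fun _ => ih h _

theorem EqualityFree.relabel {m : ℕ} (g : α → β ⊕ Fin m) {φ : L.BoundedFormula α n}
    (h : EqualityFree φ) : EqualityFree (φ.relabel g) := by
  induction φ with
  | falsum => trivial
  | equal => exact h.elim
  | rel => trivial
  | imp _ _ ih₁ ih₂ => exact ⟨ih₁ h.1, ih₂ h.2⟩
  | all _ ih => exact EqualityFree.castLE (ih h) _

theorem EqualityFree.restrictFreeVar [DecidableEq α] {φ : L.BoundedFormula α n}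
    (h : EqualityFree φ) : ∀ f : φ.freeVarFinset → β, EqualityFree (φ.restrictFreeVar f) := by
  induction φ with
  | falsum => exact fun _ => trivial
  | equal => exact h.elim
  | rel => exact fun _ => trivial
  | imp _ _ ih₁ ih₂ => exact fun _ => ⟨ih₁ h.1 _, ih₂ h.2 _⟩
  | all _ ih => exact fun _ => ih h _

theorem exists_equalityFree_conj (F : Finset (L.Formula α)) (hF : ∀ φ ∈ F, EqualityFree φ) :
    ∃ χ : L.Formula α, EqualityFree χ ∧
      ∀ (M : Type w) [L.Structure M] (s : α → M), χ.Realize s ↔ ∀ φ ∈ F, φ.Realize s := by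
  classical
  induction F using Finset.induction_on with
  | empty => exact ⟨⊤, equalityFree_top, fun M _ s => by simp⟩
  | insert φ F _ ih =>
    obtain ⟨χ, hχ, h⟩ := ih fun ψ hψ => hF ψ (Finset.mem_insert_of_mem hψ)
    refine ⟨φ ⊓ χ, EqualityFree.inf (hF φ (Finset.mem_insert_self _ _)) hχ, fun M _ s => ?_⟩
    rw [Formula.realize_inf, h, Finset.forall_mem_insert]

/-- The variables of the second kind in a formula can be quantified away existentially. -/
theorem EqualityFree.exists_projection {φ : L.Formula (α ⊕ β)} (h : EqualityFree φ) :
    ∃ χ : L.Formula α, EqualityFree χ ∧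
      ∀ (M : Type w) [Nonempty M] [L.Structure M] (s : α → M),
        χ.Realize s ↔ ∃ t : β → M, φ.Realize (Sum.elim s t) := by
  classical
  set S : Finset β := φ.freeVarFinset.toRight with hS
  let e := S.equivFin
  let g : φ.freeVarFinset → α ⊕ Fin S.card := fun x => match x with
    | ⟨Sum.inl i, _⟩ => Sum.inl i
    | ⟨Sum.inr b, hb⟩ => Sum.inr (e ⟨b, by simpa [hS] using hb⟩)
  refine ⟨((φ.restrictFreeVar g).relabel id).exs,
    ((h.restrictFreeVar g).relabel id).exs, fun M _ _ s => ?_⟩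
  rw [BoundedFormula.realize_exs]
  have key : ∀ (xs : Fin (S.card + 0) → M) (t : β → M), (∀ b : S, t b = xs (e b)) →
      (((φ.restrictFreeVar g).relabel id).Realize s xs ↔ φ.Realize (Sum.elim s t)) := by
    intro xs t ht
    rw [BoundedFormula.realize_relabel,
      BoundedFormula.realize_restrictFreeVar (Sum.elim s t), Formula.boundedFormula_realize_eq_realize]
    rintro ⟨i | b, hb⟩
    · rfl
    · have hb' : b ∈ S := by simpa [hS] using hb
      exact (ht ⟨b, hb'⟩).symm
  constructor
  · rintro ⟨xs, hxs⟩
    -- Variables outside `S` do not occur in `φ`, so any element of `M` serves as their value.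
    refine ⟨fun b => if hb : b ∈ S then xs (e ⟨b, hb⟩) else Classical.arbitrary M,
      (key xs _ fun b => ?_).1 hxs⟩
    simp
  · rintro ⟨t, ht⟩
    exact ⟨fun i => t (e.symm i), (key _ t fun b => by simp).2 ht⟩

end EqualityFree

/-! ### Compactness and one-sided extensions -/

/-- Compactness for sets of formulas with free variables. -/
theorem exists_realize_of_finite {V : Type w} (Φ : Set (L.Formula V))
    (h : ∀ F : Finset (L.Formula V), ↑F ⊆ Φ → ∃ (M : Type (max u v w)) (_ : Nonempty M)
      (_ : L.Structure M) (s : V → M), ∀ φ ∈ F, φ.Realize s) :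
    ∃ (M : Type (max u v w)) (_ : Nonempty M) (_ : L.Structure M) (s : V → M),
      ∀ φ ∈ Φ, φ.Realize s := by
  classical
  have hT : Theory.IsSatisfiable (Formula.equivSentence '' Φ : L[[V]].Theory) := by
    rw [Theory.isSatisfiable_iff_isFinitelySatisfiable]
    intro T₀ hT₀
    obtain ⟨M, _, _, s, hs⟩ := h (T₀.image Formula.equivSentence.symm) (by
      intro φ hφ
      simp only [Finset.coe_image, Set.mem_image, Finset.mem_coe] at hφ
      obtain ⟨θ, hθ, rfl⟩ := hφ
      obtain ⟨φ, hφ, rfl⟩ := hT₀ hθ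
      simpa using hφ)
    let _ := constantsOn.structure s
    have : M ⊨ (T₀ : L[[V]].Theory) := by
      refine ⟨fun θ hθ => ?_⟩
      have := hs _ (Finset.mem_image_of_mem _ hθ)
      exact (Formula.realize_equivSentence_symm M θ s).1 this
    exact Theory.Model.isSatisfiable M
  let M := hT.some
  let _ : L.Structure M := (L.lhomWithConstants V).reduct M
  refine ⟨M, inferInstance, inferInstance, fun a => (L.con a : M), fun φ hφ => ?_⟩
  rw [← Formula.realize_equivSentence]
  exact Theory.realize_sentence_of_mem _ (Set.mem_image_of_mem _ hφ)

/-- Two assignments agree on all equality-free formulas. -/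
def EqFreeEquiv (L : FirstOrder.Language.{u, v}) {I A B : Type*} [L.Structure A] [L.Structure B]
    (a : I → A) (b : I → B) : Prop :=
  ∀ φ : L.Formula I, EqualityFree φ → (φ.Realize a ↔ φ.Realize b)

theorem EqFreeEquiv.symm {I A B : Type*} [L.Structure A] [L.Structure B]
    {a : I → A} {b : I → B} (h : EqFreeEquiv L a b) : EqFreeEquiv L b a :=
  fun φ hφ => (h φ hφ).symm

/-- Equality-free formulas are closed under negation, so one implication gives the other. -/
theorem EqFreeEquiv.of_imp {I A B : Type*} [L.Structure A] [L.Structure B]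
    {a : I → A} {b : I → B}
    (h : ∀ φ : L.Formula I, EqualityFree φ → φ.Realize a → φ.Realize b) : EqFreeEquiv L a b :=
  fun φ hφ => ⟨h φ hφ, fun hb => by_contra fun ha =>
    (Formula.realize_not.1 (h φ.not hφ.not (Formula.realize_not.2 ha))) hb⟩

/-- The second structure can be mapped into an elementary extension of the first one, preserving
all equality-free formulas. -/
theorem EqFreeEquiv.exists_extension {I A B : Type (max u v w)} [Nonempty A] [Nonempty B]
    [L.Structure A] [L.Structure B] {a : I → A} {b : I → B} (hab : EqFreeEquiv L a b) :
    ∃ (C : Type (max u v w)) (_ : Nonempty C) (_ : L.Structure C) (g : A ↪ₑ[L] C) (h : B → C),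
      EqFreeEquiv L (Sum.elim (g ∘ a) h) (Sum.elim b id) := by
  classical
  -- `D` is the elementary diagram of `A`, and `S` the equality-free diagram of `B`. The relabelling
  -- `f` ties them together by reading the index `i` as the name of `a i`.
  let D : Set (L.Formula (A ⊕ B)) := {θ | ∃ χ : L.Formula A, χ.Realize id ∧
    θ = χ.relabel Sum.inl}
  let f : L.Formula (I ⊕ B) → L.Formula (A ⊕ B) := fun χ => χ.relabel (Sum.map a id)
  let S : Set (L.Formula (I ⊕ B)) := {χ | EqualityFree χ ∧ χ.Realize (Sum.elim b id)}
  obtain ⟨C, hC, _, s, hs⟩ := exists_realize_of_finite.{u, v, max u v w} (D ∪ f '' S) (by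
    intro F hF
    obtain ⟨G, hG, hGF⟩ : ∃ G : Finset (L.Formula (I ⊕ B)), ↑G ⊆ S ∧
        ∀ θ ∈ F, θ ∈ D ∨ θ ∈ G.image f := by
      obtain ⟨G, hG, hGF⟩ := Finset.subset_set_image_iff.1
        (show ↑(F.filter (· ∈ f '' S)) ⊆ f '' S from fun θ hθ => by
          simpa using (Finset.mem_filter.1 hθ).2)
      refine ⟨G, hG, fun θ hθ => (hF hθ).imp_right fun h => ?_⟩
      rw [hGF]
      exact Finset.mem_filter.2 ⟨hθ, h⟩
    obtain ⟨χ, hχ, hχ'⟩ := exists_equalityFree_conj.{u, v, max u v w} G fun φ hφ => (hG hφ).1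
    -- With the names from `B` quantified away, the formula speaks of indices only and passes from
    -- `b` to `a`. The witnesses interpret those names in `A` itself, possibly identifying some of
    -- them.
    obtain ⟨η, hη, hη'⟩ := hχ.exists_projection (L := L)
    obtain ⟨t, ht⟩ : ∃ t : B → A, χ.Realize (Sum.elim a t) :=
      (hη' A a).1 ((hab η hη).2 ((hη' B b).2 ⟨id, (hχ' B _).2 fun φ hφ => (hG hφ).2⟩))
    refine ⟨A, inferInstance, inferInstance, Sum.elim id t, fun θ hθ => ?_⟩
    obtain ⟨χ', h, rfl⟩ | h := hGF θ hθ
    · rw [Formula.realize_relabel]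
      exact h
    · obtain ⟨χ', h', rfl⟩ := Finset.mem_image.1 h
      rw [Formula.realize_relabel]
      convert (hχ' A _).1 ht χ' h' using 1
      ext (i | b) <;> rfl)
  refine ⟨C, hC, inferInstance, ⟨s ∘ Sum.inl, fun n φ x => ?_⟩, s ∘ Sum.inr,
    (EqFreeEquiv.of_imp fun φ hφ h => ?_).symm⟩
  · have key : ∀ ψ : L.Formula (Fin n), ψ.Realize x → ψ.Realize ((s ∘ Sum.inl) ∘ x) := by
      intro ψ h
      have := hs ((ψ.relabel x).relabel Sum.inl)
        (Or.inl ⟨_, by rw [Formula.realize_relabel]; exact h, rfl⟩)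
      rwa [Formula.realize_relabel, Formula.realize_relabel] at this
    refine ⟨fun h => by_contra fun h' => ?_, key φ⟩
    exact Formula.realize_not.1 (key φ.not (Formula.realize_not.2 h')) h
  · have := hs (f φ) (Or.inr ⟨φ, ⟨hφ, h⟩, rfl⟩)
    rw [Formula.realize_relabel] at this
    convert this using 1
    ext (i | b) <;> rfl

/-! ### Limits of elementary chains -/

section ElementaryChain

variable (G : ℕ → Type w) [∀ n, L.Structure (G n)] (g : ∀ n, G n ↪ₑ[L] G (n + 1))

/-- The limit of a chain of elementary embeddings. -/
abbrev ChainLimit : Type w :=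
  Language.DirectLimit G (DirectedSystem.natLERec fun n => (g n).toEmbedding)

/-- The map of a member of the chain to the limit. -/
noncomputable abbrev toLimit (n : ℕ) : G n ↪[L] ChainLimit G g :=
  Language.DirectLimit.of L ℕ G (DirectedSystem.natLERec fun n => (g n).toEmbedding) n

theorem natLERec_realize {α : Type*} {k m n : ℕ} (h : m ≤ n) (φ : L.BoundedFormula α k)
    (s : α → G m) (xs : Fin k → G m) :
    φ.Realize (DirectedSystem.natLERec (fun n => (g n).toEmbedding) m n h ∘ s)
      (DirectedSystem.natLERec (fun n => (g n).toEmbedding) m n h ∘ xs) ↔ φ.Realize s xs := by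
  induction n, h using Nat.le_induction with
  | base =>
    simp [DirectedSystem.coe_natLERec, Nat.leRecOn_self, Function.comp_def]
  | succ n h ih =>
    rw [← ih, ← (g n).map_boundedFormula φ]
    simp [DirectedSystem.coe_natLERec, Nat.leRecOn_succ h, Function.comp_def]

theorem toLimit_natLERec {m n : ℕ} (h : m ≤ n) (x : G m) :
    toLimit G g n (DirectedSystem.natLERec (fun n => (g n).toEmbedding) m n h x) =
      toLimit G g m x :=
  Language.DirectLimit.of_f

theorem toLimit_succ (n : ℕ) (x : G n) : toLimit G g (n + 1) (g n x) = toLimit G g n x := by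
  rw [← toLimit_natLERec G g n.le_succ x]
  refine congrArg (toLimit G g (n + 1)) ?_
  simp [DirectedSystem.coe_natLERec, Nat.leRecOn_succ']

/-- Tarski's elementary chain theorem. -/
theorem toLimit_realize {α : Type*} {k : ℕ} (φ : L.BoundedFormula α k) :
    ∀ {n : ℕ} (s : α → G n) (xs : Fin k → G n),
      φ.Realize (toLimit G g n ∘ s) (toLimit G g n ∘ xs) ↔ φ.Realize s xs := by
  induction φ with
  | falsum => exact fun _ _ => Iff.rfl
  | equal t₁ t₂ =>
    intro n s xs
    simp only [BoundedFormula.Realize, ← Sum.comp_elim, HomClass.realize_term]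
    exact (toLimit G g n).injective.eq_iff
  | rel R ts =>
    intro n s xs
    simp only [BoundedFormula.Realize, ← Sum.comp_elim, HomClass.realize_term]
    exact (toLimit G g n).map_rel R _
  | imp _ _ ih₁ ih₂ =>
    intro n s xs
    exact imp_congr (ih₁ s xs) (ih₂ s xs)
  | all φ ih =>
    intro n s xs
    simp only [BoundedFormula.realize_all]
    constructor
    · intro h a
      rw [← ih, Fin.comp_snoc]
      exact h _
    · intro h x
      obtain ⟨m, y, rfl⟩ := Language.DirectLimit.exists_of x
      -- The element of the limit may come from a later stage than the parameters, so both are moved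
      -- to stage `max n m`.
      let e := DirectedSystem.natLERec fun n => (g n).toEmbedding
      have hn := le_max_left n m
      have hm := le_max_right n m
      have h' := (natLERec_realize G g hn φ.all s xs).2 h (e m _ hm y)
      rw [← ih, Fin.comp_snoc] at h'
      convert h' using 1
      · ext i
        exact (toLimit_natLERec G g hn _).symm
      · congr 1
        · ext i
          exact (toLimit_natLERec G g hn _).symm
        · exact (toLimit_natLERec G g hm _).symm

theorem toLimit_realize_formula {α : Type*} (φ : L.Formula α) {n : ℕ} (s : α → G n) :
    φ.Realize (toLimit G g n ∘ s) ↔ φ.Realize s := by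
  rw [← Formula.boundedFormula_realize_eq_realize φ s default, ← toLimit_realize G g φ s default,
    Formula.boundedFormula_realize_eq_realize]

end ElementaryChain

/-! ### Back-and-forth and the common cover -/

/-- Two structures with a partial correspondence preserving equality-free formulas, given by a
pair of families with a common index type. -/
structure Correspondence (L : FirstOrder.Language.{u, v}) : Type (max u v w + 1) where
  I : Type (max u v w)
  A : Type (max u v w)
  B : Type (max u v w)
  [nonemptyA : Nonempty A]
  [nonemptyB : Nonempty B]
  [structureA : L.Structure A]
  [structureB : L.Structure B]
  a : I → A
  b : I → B
  equiv : EqFreeEquiv L a b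

attribute [instance] Correspondence.nonemptyA Correspondence.nonemptyB
  Correspondence.structureA Correspondence.structureB

/-- An extension of a correspondence by elementary embeddings, after which all elements of the
given structures are in the correspondence. -/
structure Correspondence.Extension (S T : Correspondence.{u, v, w} L) where
  ι : S.I → T.I
  f : S.A ↪ₑ[L] T.A
  g : S.B ↪ₑ[L] T.B
  map_a : ∀ i, T.a (ι i) = f (S.a i)
  map_b : ∀ i, T.b (ι i) = g (S.b i)
  surj_a : ∀ x, ∃ i, T.a i = f x
  surj_b : ∀ y, ∃ i, T.b i = g y

/-- The first application gives each element of `S.B` a partner in an elementary extension `C` of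
`S.A`. The second, with the sides exchanged, gives each element of `C` a partner in an elementary
extension of `S.B`. -/
theorem Correspondence.exists_extension (S : Correspondence.{u, v, w} L) :
    ∃ T, Nonempty (S.Extension T) := by
  obtain ⟨C, _, _, f, h, hC⟩ := EqFreeEquiv.exists_extension.{u, v, w} S.equiv
  obtain ⟨D, _, _, g, k, hD⟩ := EqFreeEquiv.exists_extension.{u, v, w} hC.symm
  exact ⟨⟨(S.I ⊕ S.B) ⊕ C, C, D, Sum.elim (Sum.elim (f ∘ S.a) h) id,
      Sum.elim (g ∘ Sum.elim S.b id) k, hD.symm⟩,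
    ⟨⟨Sum.inl ∘ Sum.inl, f, g, fun _ => rfl, fun _ => rfl, fun x => ⟨Sum.inr (f x), rfl⟩,
      fun y => ⟨Sum.inl (Sum.inr y), rfl⟩⟩⟩⟩

/-- A surjection onto a structure that preserves the functions and preserves and reflects the
relations. -/
structure IsReduction (L : FirstOrder.Language.{u, v}) {N M : Type*} [L.Structure N]
    [L.Structure M] (p : N → M) : Prop where
  surj : Function.Surjective p
  map_fun : ∀ {n : ℕ} (f : L.Functions n) (x : Fin n → N),
    p (Structure.funMap f x) = Structure.funMap f (p ∘ x)
  map_rel : ∀ {n : ℕ} (R : L.Relations n) (x : Fin n → N),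
    Structure.RelMap R x ↔ Structure.RelMap R (p ∘ x)

/-- A correspondence between two structures becomes total on both sides in suitable elementary
extensions; these are then reductions of a common structure. -/
theorem Correspondence.exists_common_cover (S : Correspondence.{u, v, w} L) :
    ∃ (N X Y : Type (max u v w)) (_ : Nonempty N) (_ : L.Structure N) (_ : L.Structure X)
      (_ : L.Structure Y) (p : N → X) (q : N → Y) (c : S.I → N),
      IsReduction L p ∧ IsReduction L q ∧
      (∀ φ : L.Formula S.I, φ.Realize (p ∘ c) ↔ φ.Realize S.a) ∧
      (∀ φ : L.Formula S.I, φ.Realize (q ∘ c) ↔ φ.Realize S.b) := by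
  choose next ext using Correspondence.exists_extension.{u, v, w} (L := L)
  let T : ℕ → Correspondence.{u, v, w} L := fun n => next^[n] S
  have e : ∀ n, Nonempty ((T n).Extension (T (n + 1))) := fun n => by
    have := ext (T n)
    rwa [show next (T n) = T (n + 1) from (Function.iterate_succ_apply' next n S).symm] at this
  let e n := (e n).some
  let X := ChainLimit (fun n => (T n).A) fun n => (e n).f
  let Y := ChainLimit (fun n => (T n).B) fun n => (e n).g
  let x n : (T n).A ↪[L] X := toLimit (fun n => (T n).A) (fun n => (e n).f) n
  let y n : (T n).B ↪[L] Y := toLimit (fun n => (T n).B) (fun n => (e n).g) n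
  let J := Σ n, (T n).I
  let a : J → X := fun j => x j.1 ((T j.1).a j.2)
  let b : J → Y := fun j => y j.1 ((T j.1).b j.2)
  have hlift : ∀ (j : J) (m : ℕ), j.1 ≤ m → ∃ i : (T m).I,
      x m ((T m).a i) = a j ∧ y m ((T m).b i) = b j := by
    intro j m hm
    induction m, hm using Nat.le_induction with
    | base => exact ⟨j.2, rfl, rfl⟩
    | succ m _ ih =>
      obtain ⟨i, h₁, h₂⟩ := ih
      refine ⟨(e m).ι i, ?_, ?_⟩
      · rw [(e m).map_a, ← h₁]
        exact toLimit_succ (fun n => (T n).A) (fun n => (e n).f) m _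
      · rw [(e m).map_b, ← h₂]
        exact toLimit_succ (fun n => (T n).B) (fun n => (e n).g) m _
  -- A term involves finitely many indices, each of which persists to all later stages. Quantifying
  -- over all `m ≥ n` lets several terms share one stage.
  have hterm : ∀ t : L.Term J, ∃ n, ∀ m, n ≤ m → ∃ t' : L.Term (T m).I,
      x m (t'.realize (T m).a) = t.realize a ∧ y m (t'.realize (T m).b) = t.realize b := by
    intro t
    induction t with
    | var j =>
      refine ⟨j.1, fun m hm => ?_⟩
      obtain ⟨i, hi⟩ := hlift j m hm
      exact ⟨Term.var i, hi⟩
    | func f ts ih =>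
      choose n hn using ih
      refine ⟨Finset.univ.sup n, fun m hm => ?_⟩
      choose t' h₁ h₂ using fun i => hn i m ((Finset.le_sup (Finset.mem_univ i)).trans hm)
      refine ⟨Term.func f t', ?_, ?_⟩
      · simp only [Term.realize_func, ← h₁]
        exact (x m).map_fun f _
      · simp only [Term.realize_func, ← h₂]
        exact (y m).map_fun f _
  -- On the term algebra both evaluations respect functions automatically. Relations are pulled back
  -- from `X`, so only their agreement with `Y` needs an argument.
  let _ : L.Structure (L.Term J) :=
    { funMap := fun f ts => Term.func f ts
      RelMap := fun R ts => Structure.RelMap R fun i => (ts i).realize a }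
  have hp : ∀ z : X, ∃ j, a j = z := fun z => by
    obtain ⟨n, z, rfl⟩ := Language.DirectLimit.exists_of z
    obtain ⟨i, hi⟩ := (e n).surj_a z
    refine ⟨⟨n + 1, i⟩, ?_⟩
    change x (n + 1) ((T (n + 1)).a i) = _
    rw [hi]
    exact toLimit_succ (fun n => (T n).A) (fun n => (e n).f) n z
  have hq : ∀ z : Y, ∃ j, b j = z := fun z => by
    obtain ⟨n, z, rfl⟩ := Language.DirectLimit.exists_of z
    obtain ⟨i, hi⟩ := (e n).surj_b z
    refine ⟨⟨n + 1, i⟩, ?_⟩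
    change y (n + 1) ((T (n + 1)).b i) = _
    rw [hi]
    exact toLimit_succ (fun n => (T n).B) (fun n => (e n).g) n z
  refine ⟨L.Term J, X, Y, ?_, inferInstance, inferInstance, inferInstance,
    fun t => t.realize a, fun t => t.realize b, fun i => Term.var ⟨0, i⟩,
    ⟨fun z => ?_, fun _ _ => rfl, fun _ _ => Iff.rfl⟩,
    ⟨fun z => ?_, fun _ _ => rfl, fun {k} R ts => ?_⟩, fun φ => ?_, fun φ => ?_⟩
  · obtain ⟨j, -⟩ := hp (x 0 (Classical.arbitrary (T 0).A))
    exact ⟨Term.var j⟩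
  · obtain ⟨j, hj⟩ := hp z
    exact ⟨Term.var j, hj⟩
  · obtain ⟨j, hj⟩ := hq z
    exact ⟨Term.var j, hj⟩
  · choose n hn using fun i => hterm (ts i)
    choose t' h₁ h₂ using fun i => hn i _ (Finset.le_sup (Finset.mem_univ i))
    change Structure.RelMap R (fun i => (ts i).realize a) ↔
      Structure.RelMap R fun i => (ts i).realize b
    simp only [← h₁, ← h₂]
    refine ((x _).map_rel R _).trans (Iff.trans ?_ ((y _).map_rel R _).symm)
    -- A relational atom is equality-free, so the correspondence at this stage transfers it.
    have := (T (Finset.univ.sup n)).equiv (R.formula t') trivial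
    rwa [Formula.realize_rel, Formula.realize_rel] at this
  · exact toLimit_realize_formula (fun n => (T n).A) (fun n => (e n).f) φ (n := 0) S.a
  · exact toLimit_realize_formula (fun n => (T n).B) (fun n => (e n).g) φ (n := 0) S.b

/-! ### The translation `φ*` and quotients by `E` -/

theorem star_eq_onBoundedFormula {α : Type*} {n : ℕ} {φ : L.BoundedFormula α n}
    (h : EqualityFree φ) : star φ = (incl L).onBoundedFormula φ := by
  induction φ with
  | falsum => rfl
  | equal => exact h.elim
  | rel => rfl
  | imp _ _ ih₁ ih₂ => exact congrArg₂ _ (ih₁ h.1) (ih₂ h.2)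
  | all _ ih => exact congrArg _ (ih h)

/-- `E` is interpreted as the kernel of a reduction onto an `L`-structure. -/
structure IsEQuotient {N M : Type*} [(WithE L).Structure N] [L.Structure M] (p : N → M) :
    Prop where
  surj : Function.Surjective p
  map_fun : ∀ {n : ℕ} (f : L.Functions n) (x : Fin n → N),
    p (Structure.funMap ((incl L).onFunction f) x) = Structure.funMap f (p ∘ x)
  map_rel : ∀ {n : ℕ} (R : L.Relations n) (x : Fin n → N),
    Structure.RelMap ((incl L).onRelation R) x ↔ Structure.RelMap R (p ∘ x)
  ker : ∀ x y : N, Structure.RelMap (symE L) ![x, y] ↔ p x = p y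

theorem IsEQuotient.realize_term {N M : Type*} [(WithE L).Structure N] [L.Structure M]
    {p : N → M} (hp : IsEQuotient (L := L) p) {β : Type*} (t : L.Term β) (s : β → N) :
    p (((incl L).onTerm t).realize s) = t.realize (p ∘ s) := by
  induction t with
  | var => rfl
  | func f ts ih =>
    simp only [LHom.onTerm, Term.realize_func, hp.map_fun, ← ih]
    rfl

/-- The kernel condition settles equality atoms, and surjectivity lets a quantifier over `N` reach
all of `M`. -/
theorem IsEQuotient.realize_star {N M : Type*} [(WithE L).Structure N] [L.Structure M]
    {p : N → M} (hp : IsEQuotient (L := L) p) {α : Type*} {n : ℕ} (φ : L.BoundedFormula α n)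
    (s : α → N) (xs : Fin n → N) : (star φ).Realize s xs ↔ φ.Realize (p ∘ s) (p ∘ xs) := by
  induction φ with
  | falsum => exact Iff.rfl
  | equal t₁ t₂ =>
    simp only [star, BoundedFormula.realize_rel₂, hp.ker, hp.realize_term, Sum.comp_elim,
      BoundedFormula.Realize]
  | rel R ts =>
    simp only [star, BoundedFormula.realize_rel, hp.map_rel, BoundedFormula.Realize,
      Function.comp_def, hp.realize_term]
    simp only [← Function.comp_def, Sum.comp_elim]
  | imp _ _ ih₁ ih₂ => exact imp_congr (ih₁ xs) (ih₂ xs)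
  | all φ ih =>
    simp only [star, BoundedFormula.realize_all, ih, Fin.comp_snoc]
    exact (hp.surj.forall (p := fun a => φ.Realize (p ∘ s) (Fin.snoc (p ∘ xs) a))).symm

theorem IsEQuotient.realize_star_formula {N M : Type*} [(WithE L).Structure N] [L.Structure M]
    {p : N → M} (hp : IsEQuotient (L := L) p) {α : Type*} (φ : L.Formula α) (s : α → N) :
    Formula.Realize (star φ) s ↔ φ.Realize (p ∘ s) := by
  have := hp.realize_star φ s default
  rwa [Formula.boundedFormula_realize_eq_realize, Formula.boundedFormula_realize_eq_realize]
    at this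

/-- `E` is interpreted as a congruence. -/
structure IsECongruence (L : FirstOrder.Language.{u, v}) (N : Type*) [(WithE L).Structure N] :
    Prop where
  refl : ∀ x : N, Structure.RelMap (symE L) ![x, x]
  symm : ∀ x y : N, Structure.RelMap (symE L) ![x, y] → Structure.RelMap (symE L) ![y, x]
  trans : ∀ x y z : N, Structure.RelMap (symE L) ![x, y] → Structure.RelMap (symE L) ![y, z] →
    Structure.RelMap (symE L) ![x, z]
  map_fun : ∀ {n : ℕ} (f : L.Functions n) (x y : Fin n → N),
    (∀ i, Structure.RelMap (symE L) ![x i, y i]) →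
    Structure.RelMap (symE L) ![Structure.funMap ((incl L).onFunction f) x,
      Structure.funMap ((incl L).onFunction f) y]
  map_rel : ∀ {n : ℕ} (R : L.Relations n) (x y : Fin n → N),
    (∀ i, Structure.RelMap (symE L) ![x i, y i]) →
    (Structure.RelMap ((incl L).onRelation R) x ↔ Structure.RelMap ((incl L).onRelation R) y)

/-! ### Semantics of the congruence axioms -/

section Axioms

variable {α : Type w} {N : Type*} [(WithE L).Structure N] (s : α → N)

theorem realize_atomE {n : ℕ} (i j : Fin n) (xs : Fin n → N) :
    (atomE (L := L) i j).Realize s xs ↔ Structure.RelMap (symE L) ![xs i, xs j] := by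
  simp [atomE, BoundedFormula.realize_rel₂]

theorem realize_reflAxiom :
    (reflAxiom L α).Realize s ↔ ∀ x : N, Structure.RelMap (symE L) ![x, x] := by
  simp only [reflAxiom, BoundedFormula.realize_alls, realize_atomE]
  exact ⟨fun h x => h fun _ => x, fun h xs => h _⟩

theorem realize_symmAxiom : (symmAxiom L α).Realize s ↔
    ∀ x y : N, Structure.RelMap (symE L) ![x, y] → Structure.RelMap (symE L) ![y, x] := by
  simp only [symmAxiom, BoundedFormula.realize_alls, BoundedFormula.realize_imp, realize_atomE]
  exact ⟨fun h x y => h ![x, y], fun h xs => h _ _⟩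

theorem realize_transAxiom : (transAxiom L α).Realize s ↔
    ∀ x y z : N, Structure.RelMap (symE L) ![x, y] → Structure.RelMap (symE L) ![y, z] →
      Structure.RelMap (symE L) ![x, z] := by
  simp only [transAxiom, BoundedFormula.realize_alls, BoundedFormula.realize_imp, realize_atomE]
  exact ⟨fun h x y z => h ![x, y, z], fun h xs => h _ _ _⟩

theorem realize_pairwiseE {n : ℕ} (xs : Fin (n + n) → N) :
    (pairwiseE (L := L) n).Realize s xs ↔
      ∀ i, Structure.RelMap (symE L) ![xs (Fin.castAdd n i), xs (Fin.natAdd n i)] := by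
  simp only [pairwiseE, BoundedFormula.realize_iInf, realize_atomE]

theorem forall_fin_add {n : ℕ} {P : (Fin n → N) → (Fin n → N) → Prop} :
    (∀ xs : Fin (n + n) → N, P (fun i => xs (Fin.castAdd n i)) fun i => xs (Fin.natAdd n i)) ↔
      ∀ x y, P x y :=
  ⟨fun h x y => by simpa only [Fin.append_left, Fin.append_right] using h (Fin.append x y), fun h _ => h _ _⟩

theorem realize_compatAxiom_function {n : ℕ} (f : L.Functions n) :
    (compatAxiom α (Sum.inl ⟨n, f⟩ : L.Symbols)).Realize s ↔ ∀ x y : Fin n → N,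
      (∀ i, Structure.RelMap (symE L) ![x i, y i]) →
      Structure.RelMap (symE L) ![Structure.funMap ((incl L).onFunction f) x,
        Structure.funMap ((incl L).onFunction f) y] := by
  rw [← forall_fin_add]
  simp only [compatAxiom, BoundedFormula.realize_alls, BoundedFormula.realize_imp,
    realize_pairwiseE, BoundedFormula.realize_rel₂, leftTerm, rightTerm, Term.realize_func,
    Term.realize_var, Sum.elim_inr]

theorem realize_compatAxiom_relation {n : ℕ} (R : L.Relations n) :
    (compatAxiom α (Sum.inr ⟨n, R⟩ : L.Symbols)).Realize s ↔ ∀ x y : Fin n → N,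
      (∀ i, Structure.RelMap (symE L) ![x i, y i]) →
      (Structure.RelMap ((incl L).onRelation R) x ↔
        Structure.RelMap ((incl L).onRelation R) y) := by
  rw [← forall_fin_add]
  simp only [compatAxiom, BoundedFormula.realize_alls, BoundedFormula.realize_imp,
    realize_pairwiseE, BoundedFormula.realize_iff, leftAtom, rightAtom,
    BoundedFormula.realize_rel, Term.realize_var, Sum.elim_inr]

theorem realize_congruenceAxioms :
    (∀ γ ∈ congruenceAxioms L α, γ.Realize s) ↔ IsECongruence L N := by
  simp only [congruenceAxioms, Set.mem_union, Set.mem_insert_iff, Set.mem_singleton_iff,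
    Set.mem_range]
  constructor
  · intro h
    exact ⟨(realize_reflAxiom s).1 (h _ (by simp)), (realize_symmAxiom s).1 (h _ (by simp)),
      (realize_transAxiom s).1 (h _ (by simp)),
      fun f => (realize_compatAxiom_function s f).1 (h _ (Or.inr ⟨_, rfl⟩)),
      fun R => (realize_compatAxiom_relation s R).1 (h _ (Or.inr ⟨_, rfl⟩))⟩
  · rintro h γ ((rfl | rfl | rfl) | ⟨⟨n, f⟩ | ⟨n, R⟩, rfl⟩)
    · exact (realize_reflAxiom s).2 h.refl
    · exact (realize_symmAxiom s).2 h.symm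
    · exact (realize_transAxiom s).2 h.trans
    · exact (realize_compatAxiom_function s f).2 (h.map_fun f)
    · exact (realize_compatAxiom_relation s R).2 (h.map_rel R)

theorem realize_deltaE [Finite L.Symbols] :
    (deltaE L α).Realize s ↔ ∀ γ ∈ congruenceAxioms L α, γ.Realize s := by
  have : Formula.Realize (BoundedFormula.iInf (compatAxiom (L := L) α)) s ↔
      ∀ x, (compatAxiom α x).Realize s := Formula.realize_iInf
  simp only [deltaE, Formula.realize_inf, this, congruenceAxioms, Set.mem_union,
    Set.mem_insert_iff, Set.mem_singleton_iff, or_imp, forall_and, forall_eq,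
    Set.forall_mem_range, and_assoc]

end Axioms

/-! ### Congruences as kernels -/

theorem IsEQuotient.isECongruence {N M : Type*} [(WithE L).Structure N] [L.Structure M]
    {p : N → M} (hp : IsEQuotient (L := L) p) : IsECongruence L N where
  refl x := (hp.ker x x).2 rfl
  symm x y h := (hp.ker y x).2 ((hp.ker x y).1 h).symm
  trans x y z h₁ h₂ := (hp.ker x z).2 (((hp.ker x y).1 h₁).trans ((hp.ker y z).1 h₂))
  map_fun f x y h := by
    rw [hp.ker, hp.map_fun, hp.map_fun]
    exact congrArg _ (funext fun i => (hp.ker _ _).1 (h i))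
  map_rel R x y h := by
    rw [hp.map_rel, hp.map_rel, show p ∘ x = p ∘ y from funext fun i => (hp.ker _ _).1 (h i)]

theorem IsECongruence.exists_quotient {N : Type w} [(WithE L).Structure N]
    (h : IsECongruence L N) : ∃ (M : Type w) (_ : L.Structure M) (p : N → M),
      IsEQuotient (L := L) p := by
  let r : Setoid N := ⟨fun x y => Structure.RelMap (symE L) ![x, y],
    h.refl, fun {x y} => h.symm x y, fun {x y z} => h.trans x y z⟩
  let _ : L.Prestructure r :=
    { toStructure := (incl L).reduct N
      fun_equiv := fun {n f} x y hxy => h.map_fun f x y hxy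
      rel_equiv := fun {n R} x y hxy => propext (h.map_rel R x y hxy) }
  refine ⟨Quotient r, inferInstance, Quotient.mk r, Quotient.mk_surjective, fun f x => ?_,
    fun R x => ?_, fun x y => (Quotient.eq (r := r)).symm⟩
  · exact (funMap_quotient_mk' r f x).symm
  · exact (relMap_quotient_mk' r R x).symm

/-- A reduction of `L`-structures, with `E` interpreted as its kernel. -/
theorem IsReduction.exists_expansion {N M : Type*} [L.Structure N] [L.Structure M] {p : N → M}
    (hp : IsReduction L p) : ∃ _ : (WithE L).Structure N,
      IsEQuotient (L := L) p ∧ (incl L).IsExpansionOn N := by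
  let _ : LE.Structure N :=
    { funMap := fun f => Empty.elim f
      RelMap := fun R => match R with
        | ESymb.E => fun x => p (x 0) = p (x 1) }
  exact ⟨inferInstance, ⟨hp.surj, hp.map_fun, hp.map_rel, fun _ _ => Iff.rfl⟩, inferInstance⟩

/-! ### Preservation and definability -/

section Main

variable {α : Type w} {Γ : Set (L.Formula α)} {ψ : L.Formula α}

theorem EquivModulo.star {φ : L.Formula α} (hφ : EqualityFree φ) (h : EquivModulo Γ ψ φ) :
    EquivModulo (EqElim.star '' Γ ∪ congruenceAxioms L α) (EqElim.star ψ)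
      ((incl L).onFormula φ) := by
  intro N _ _ s hs
  obtain ⟨M, _, p, hp⟩ := ((realize_congruenceAxioms s).1 fun γ hγ =>
    hs γ (Or.inr hγ)).exists_quotient
  have hM : Nonempty M := ‹Nonempty N›.map p
  have hφ' : (incl L).onFormula φ = EqElim.star φ := (star_eq_onBoundedFormula hφ).symm
  rw [hφ', hp.realize_star_formula, hp.realize_star_formula]
  exact h M (p ∘ s) fun γ hγ =>
    (hp.realize_star_formula γ s).1 (hs _ (Or.inl (Set.mem_image_of_mem _ hγ)))

theorem EquivModulo.realize_iff_of_eqFreeEquiv {μ : L.Formula α}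
    (h : EquivModulo (EqElim.star '' Γ ∪ congruenceAxioms L α) (EqElim.star ψ)
      ((incl L).onFormula μ))
    {A B : Type (max u v w)} [Nonempty A] [Nonempty B] [L.Structure A] [L.Structure B]
    {s : α → A} {t : α → B} (hst : EqFreeEquiv L s t) (hs : ∀ γ ∈ Γ, γ.Realize s)
    (ht : ∀ γ ∈ Γ, γ.Realize t) : ψ.Realize s ↔ ψ.Realize t := by
  let S : Correspondence.{u, v, w} L :=
    -- The variables are lifted so that indices and structures lie in one universe.
    { I := ULift.{max u v} α
      A := A
      B := B
      a := s ∘ ULift.down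
      b := t ∘ ULift.down
      equiv := fun φ hφ => by
        have := hst (φ.relabel ULift.down) (EqualityFree.relabel _ hφ)
        rwa [Formula.realize_relabel, Formula.realize_relabel] at this }
  obtain ⟨N, X, Y, _, _, _, _, p, q, c, hp, hq, ha, hb⟩ := S.exists_common_cover
  -- Here `r` stands for `p` or `q`. The symbol `E` is read as the kernel of `r`, while `μ` is
  -- evaluated in the `L`-structure `N`, which does not depend on `r`.
  have transfer : ∀ {Z C : Type (max u v w)} [L.Structure Z] [L.Structure C] {r : N → Z}
      {z : α → C}, IsReduction L r →
      (∀ φ : L.Formula (ULift.{max u v} α), φ.Realize (r ∘ c) ↔ φ.Realize (z ∘ ULift.down)) →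
      (∀ γ ∈ Γ, γ.Realize z) → (ψ.Realize z ↔ μ.Realize (c ∘ ULift.up)) := by
    intro Z C _ _ r z hr hz hΓ
    have hz' : ∀ φ : L.Formula α, φ.Realize (r ∘ (c ∘ ULift.up)) ↔ φ.Realize z := by
      intro φ
      have := hz (φ.relabel ULift.up)
      rwa [Formula.realize_relabel, Formula.realize_relabel] at this
    obtain ⟨_, hr', hexp⟩ := hr.exists_expansion
    have := h N (c ∘ ULift.up) (by
      rintro γ (⟨γ, hγ, rfl⟩ | hγ)
      · exact (hr'.realize_star_formula γ _).2 ((hz' γ).2 (hΓ γ hγ))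
      · exact (realize_congruenceAxioms _).2 hr'.isECongruence γ hγ)
    rwa [hr'.realize_star_formula, hz', LHom.realize_onFormula] at this
  exact (transfer hp ha hs).trans (transfer hq hb ht).symm

/-- Let `C` be the equality-free consequences of `Γ ∪ {ψ}`. If `Γ ∪ C` did not imply `ψ`, the
equality-free type of a counterexample would be consistent with `Γ ∪ {ψ}`, against the preservation
hypothesis. Compactness then cuts `C` down to a finite conjunction. -/
theorem exists_equalityFree_of_eqFreeEquiv
    (h : ∀ (A B : Type (max u v w)) [Nonempty A] [Nonempty B] [L.Structure A] [L.Structure B]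
      (s : α → A) (t : α → B), EqFreeEquiv L s t → (∀ γ ∈ Γ, γ.Realize s) →
      (∀ γ ∈ Γ, γ.Realize t) → ψ.Realize s → ψ.Realize t) :
    ∃ φ : L.Formula α, EqualityFree φ ∧ EquivModulo Γ ψ φ := by
  classical
  let C : Set (L.Formula α) := {φ | EqualityFree φ ∧
    ∀ (M : Type max u v w) [Nonempty M] [L.Structure M] (s : α → M),
      (∀ γ ∈ Γ, γ.Realize s) → ψ.Realize s → φ.Realize s}
  have unsat : ¬ ∃ (M : Type (max u v w)) (_ : Nonempty M) (_ : L.Structure M) (s : α → M),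
      ∀ φ ∈ Γ ∪ {ψ.not} ∪ C, φ.Realize s := by
    rintro ⟨B, _, _, t, ht⟩
    let D : Set (L.Formula α) := {φ | EqualityFree φ ∧ φ.Realize t}
    obtain ⟨A, _, _, s, hs⟩ := exists_realize_of_finite.{u, v, w} (Γ ∪ {ψ} ∪ D) (by
      intro F hF
      by_contra hno
      obtain ⟨χ, hχ, hχ'⟩ := exists_equalityFree_conj.{u, v, max u v w} (F.filter (· ∈ D))
        fun φ hφ => (Finset.mem_filter.1 hφ).2.1
      -- If this finite part is unsatisfiable, the negated conjunction of its members from `D`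
      -- follows from `Γ ∪ {ψ}`, yet it fails at `t`.
      have hmem : χ.not ∈ C := by
        refine ⟨hχ.not, fun M _ _ s hΓ hψ => Formula.realize_not.2 fun hs => hno ?_⟩
        refine ⟨M, inferInstance, inferInstance, s, fun φ hφ => ?_⟩
        obtain (hφ' | rfl) | hφ' := hF hφ
        · exact hΓ φ hφ'
        · exact hψ
        · exact (hχ' M s).1 hs φ (Finset.mem_filter.2 ⟨hφ, hφ'⟩)
      exact Formula.realize_not.1 (ht _ (Or.inr hmem))
        ((hχ' B t).2 fun φ hφ => (Finset.mem_filter.1 hφ).2.2))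
    refine Formula.realize_not.1 (ht ψ.not (Or.inl (Or.inr rfl))) (h A B s t
      (EqFreeEquiv.symm (EqFreeEquiv.of_imp fun φ hφ hφt => hs φ (Or.inr ⟨hφ, hφt⟩)))
      (fun γ hγ => hs γ (Or.inl (Or.inl hγ))) (fun γ hγ => ht γ (Or.inl (Or.inl hγ)))
      (hs ψ (Or.inl (Or.inr rfl))))
  obtain ⟨F, hF, hno⟩ : ∃ F : Finset (L.Formula α), ↑F ⊆ Γ ∪ {ψ.not} ∪ C ∧
      ¬ ∃ (M : Type (max u v w)) (_ : Nonempty M) (_ : L.Structure M) (s : α → M),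
        ∀ φ ∈ F, φ.Realize s := by
    by_contra hcon
    exact unsat (exists_realize_of_finite.{u, v, w} _ fun F hF =>
      by_contra fun hno => hcon ⟨F, hF, hno⟩)
  obtain ⟨χ, hχ, hχ'⟩ := exists_equalityFree_conj.{u, v, max u v w} (F.filter (· ∈ C))
    fun φ hφ => (Finset.mem_filter.1 hφ).2.1
  refine ⟨χ, hχ, fun M _ _ s hs => ⟨fun hψ => (hχ' M s).2 fun φ hφ =>
    (Finset.mem_filter.1 hφ).2.2 M s hs hψ, fun hχs => by_contra fun hψ => hno ?_⟩⟩
  refine ⟨M, inferInstance, inferInstance, s, fun φ hφ => ?_⟩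
  obtain (hφ' | rfl) | hφ' := hF hφ
  · exact hs φ hφ'
  · exact Formula.realize_not.2 hψ
  · exact (hχ' M s).1 hχs φ (Finset.mem_filter.2 ⟨hφ, hφ'⟩)

theorem exists_equalityFree_iff :
    (∃ φ : L.Formula α, EqualityFree φ ∧ EquivModulo Γ ψ φ) ↔
      ∃ μ : L.Formula α, EquivModulo (star '' Γ ∪ congruenceAxioms L α) (star ψ)
        ((incl L).onFormula μ) :=
  ⟨fun ⟨φ, hφ, h⟩ => ⟨φ, h.star hφ⟩, fun ⟨_, h⟩ => exists_equalityFree_of_eqFreeEquiv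
    fun _ _ _ _ _ _ _ _ hst hs ht => (h.realize_iff_of_eqFreeEquiv hst hs ht).1⟩

theorem equivModulo_deltaE [Finite L.Symbols] {Δ : Set ((WithE L).Formula α)}
    {φ χ : (WithE L).Formula α} :
    EquivModulo (Δ ∪ {deltaE L α}) φ χ ↔ EquivModulo (Δ ∪ congruenceAxioms L α) φ χ := by
  have key : ∀ (M : Type max u v w) [(WithE L).Structure M] (s : α → M),
      (∀ γ ∈ Δ ∪ {deltaE L α}, γ.Realize s) ↔ ∀ γ ∈ Δ ∪ congruenceAxioms L α, γ.Realize s := by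
    intro M _ s
    simp only [Set.mem_union, or_imp, forall_and, ← realize_deltaE s, Set.mem_singleton_iff,
      forall_eq]
  exact ⟨fun h M _ _ s hs => h M s ((key M s).2 hs), fun h M _ _ s hs => h M s ((key M s).1 hs)⟩

end Main

end EqElim

theorem mainTheorem1 {L : FirstOrder.Language.{u, v}} {α : Type w}
    (ψ : L.Formula α) (Γ : Set (L.Formula α)) (hΓ : Γ.Finite) :
    ((∃ φ : L.Formula α, EqElim.EqualityFree φ ∧ EqElim.EquivModulo Γ ψ φ) ↔
      ∃ μ : L.Formula α,
        EqElim.EquivModulo (EqElim.star '' Γ ∪ EqElim.congruenceAxioms L α)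
          (EqElim.star ψ) ((EqElim.incl L).onFormula μ)) ∧
    ∀ [Finite L.Symbols],
      ((∃ φ : L.Formula α, EqElim.EqualityFree φ ∧ EqElim.EquivModulo Γ ψ φ) ↔
        ∃ μ : L.Formula α,
          EqElim.EquivModulo (EqElim.star '' Γ ∪ {EqElim.deltaE L α})
            (EqElim.star ψ) ((EqElim.incl L).onFormula μ)) := by
  exact ⟨EqElim.exists_equalityFree_iff, by
    intro _
    simp only [EqElim.equivModulo_deltaE]
    exact EqElim.exists_equalityFree_iff⟩
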